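/- Let $K$ be an algebraically closed field of characteristic $0$ and let $g\ge 3$ be an integer. Let $F_g$ be the free Lie algebra over $K$ on $g$ generators, with lower central series $F_g^1=F_g$, $F_g^{k+1}=[F_g,F_g^k]$, and let $F_{g,3}=F_g/F_g^4$ be the free-nilpotent Lie algebra of nilpotency class $3$ on $g$ generators. For a finite-dimensional Lie algebra $\mathfrak g$ over $K$, let $Z(\mathfrak g)$ be its center, let $\alpha(\mathfrak g)$ be the maximal dimension of an abelian subalgebra of $\mathfrak g$, and let $$\chi(\mathfrak g)=\inf\{\dim \mathfrak g(\ell)\mid \ell\in\mathfrak g^*\},\qquad \mathfrak g(\ell)=\{y\in\mathfrak g\mid \ell([x,y])=0\ \text{for all } x\in\mathfrak g\},$$ be its index. Then $F_{g,3}$ is finite-dimensional and $$\alpha(F_{g,3})=\dim Z(F_{g,3})+\binom g2=\chi(F_{g,3})+g=\frac{2g^3+3g^2-5g}{6}.$$ -/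

import Mathlib

/-- The free-nilpotent Lie algebra `F_{g,c} = F_g / F_g^{c+1}` on `g` generators.
Here `F_g^1 = F_g` and `F_g^{k+1} = [F_g, F_g^k]`; Mathlib's lower central series starts at
index `0`, so that `F_g^{c+1}` is its term with index `c`. -/
abbrev FreeNilpotentLieAlgebra (K : Type*) [Field K] (g c : ℕ) : Type _ :=
  FreeLieAlgebra K (Fin g) ⧸
    LieModule.lowerCentralSeries K (FreeLieAlgebra K (Fin g)) (FreeLieAlgebra K (Fin g)) c

/-- The radical `L(ℓ) = {y | ℓ([x, y]) = 0 for all x}` of the skew-symmetric bilinear form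
`(x, y) ↦ ℓ([x, y])`, a Lie subalgebra of `L`. -/
def lieFormRadical {K L : Type*} [Field K] [LieRing L] [LieAlgebra K L]
    (l : Module.Dual K L) : LieSubalgebra K L where
  carrier := {y | ∀ x : L, l ⁅x, y⁆ = 0}
  zero_mem' := by intro x; simp
  add_mem' := by
    intro y z hy hz x
    rw [lie_add, map_add, hy x, hz x, add_zero]
  smul_mem' := by
    intro t y hy x
    rw [lie_smul, map_smul, hy x, smul_zero]
  lie_mem' := by
    intro y z hy hz x
    have h : l ⁅y, ⁅x, z⁆⁆ = 0 := by
      rw [← lie_skew, map_neg, hy ⁅x, z⁆, neg_zero]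
    rw [leibniz_lie, map_add, hz ⁅x, y⁆, h, add_zero]

/-- The index `χ(L) = inf {dim L(ℓ) | ℓ ∈ L^*}` of a finite-dimensional Lie algebra `L`. -/
noncomputable def lieIndex (K L : Type*) [Field K] [LieRing L] [LieAlgebra K L] : ℕ :=
  sInf {d : ℕ | ∃ l : Module.Dual K L, d = Module.finrank K (lieFormRadical l)}

/-- The maximal dimension `α(L)` of an abelian subalgebra of a finite-dimensional Lie
algebra `L` (in finite dimension the set is non-empty and bounded, so `sSup` is its maximum). -/
noncomputable def lieAlpha (K L : Type*) [Field K] [LieRing L] [LieAlgebra K L] : ℕ :=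
  sSup {d : ℕ | ∃ A : LieSubalgebra K L, IsLieAbelian A ∧ d = Module.finrank K A}

/-! Write `L` for the class-3 algebra and `D` for its derived subalgebra, spanned by brackets of
degree 2 and 3; `D` is abelian because `[D, D]` lies in degree at least 4. For every abelian
subalgebra `A` and every linear form `ℓ`, `A` is isotropic for `(x, y) ↦ ℓ([x, y])`, so `2 dim A ≤
dim L + dim L(ℓ)` (`two_mul_finrank_le_of_isLieAbelian`). A single pair `(A, ℓ)` with equality
therefore determines both `α` and `χ` (`lieAlpha_lieIndex_eq`). The pair used is `A = D` and `ℓ =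
cyclicForm K σ`, where `σ` has no cycle of length 1 or 2; such a `σ` exists because `g ≥ 3`. This
form has rank at least `2g`, as the pairings with the `x_k` and the `[x_k, x_{σ k}]` are independent
(`range_cyclicPairing`), and `dim L = g + dim D` makes this exactly what equality requires.
Dimensions come from a Hall basis; the center is the degree-3 part, of dimension `(g³ - g)/3`. -/

namespace FreeNilpotentLieAlgebra

/-! ### Nilpotency and the universal property in class three. -/

section UniversalProperty

variable {K : Type*} [Field K] {g : ℕ}

/-- The generators of the free-nilpotent Lie algebra. -/
noncomputable def gen (K : Type*) [Field K] {g : ℕ} (i : Fin g) : FreeNilpotentLieAlgebra K g 3 :=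
  LieSubmodule.Quotient.mk (FreeLieAlgebra.of K i)

theorem lie_lie_lie_eq_zero (a b c d : FreeNilpotentLieAlgebra K g 3) :
    ⁅a, ⁅b, ⁅c, d⁆⁆⁆ = 0 := by
  obtain ⟨a, rfl⟩ := LieSubmodule.Quotient.surjective_mk' _ a
  obtain ⟨b, rfl⟩ := LieSubmodule.Quotient.surjective_mk' _ b
  obtain ⟨c, rfl⟩ := LieSubmodule.Quotient.surjective_mk' _ c
  obtain ⟨d, rfl⟩ := LieSubmodule.Quotient.surjective_mk' _ d
  change (LieSubmodule.Quotient.mk ⁅a, ⁅b, ⁅c, d⁆⁆⁆ : FreeNilpotentLieAlgebra K g 3) = 0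
  rw [LieSubmodule.Quotient.mk_eq_zero', LieModule.lowerCentralSeries_succ,
    LieModule.lowerCentralSeries_succ, LieModule.lowerCentralSeries_succ,
    LieModule.lowerCentralSeries_zero]
  exact LieSubmodule.lie_mem_lie (LieSubmodule.mem_top a) (LieSubmodule.lie_mem_lie
    (LieSubmodule.mem_top b) (LieSubmodule.lie_mem_lie (LieSubmodule.mem_top c)
      (LieSubmodule.mem_top d)))

theorem lie_lie_of_lie_eq_zero (a b c d : FreeNilpotentLieAlgebra K g 3) :
    ⁅⁅a, b⁆, ⁅c, d⁆⁆ = 0 := by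
  rw [lie_lie, lie_lie_lie_eq_zero, lie_lie_lie_eq_zero, sub_zero]

/-- The canonical projection, as a morphism of Lie algebras. -/
noncomputable def proj (K : Type*) [Field K] (g : ℕ) :
    FreeLieAlgebra K (Fin g) →ₗ⁅K⁆ FreeNilpotentLieAlgebra K g 3 where
  toFun x := LieSubmodule.Quotient.mk x
  map_add' _ _ := rfl
  map_smul' _ _ := rfl
  map_lie' := rfl

/-- The projection from the free Lie algebra factors through the inclusion of `S`, because both maps
agree on generators. -/
theorem lieSubalgebra_eq_top (S : LieSubalgebra K (FreeNilpotentLieAlgebra K g 3))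
    (h : ∀ i, gen K i ∈ S) : S = ⊤ := by
  have key : S.incl.comp (FreeLieAlgebra.lift K fun i => ⟨gen K i, h i⟩) = proj K g := by
    apply FreeLieAlgebra.hom_ext
    intro i
    simp only [LieHom.comp_apply, FreeLieAlgebra.lift_of_apply]
    rfl
  rw [eq_top_iff]
  intro x _
  obtain ⟨x, rfl⟩ := LieSubmodule.Quotient.surjective_mk' _ x
  have := LieHom.congr_fun key x
  change proj K g x ∈ S
  rw [← this]
  exact Subtype.property _

variable {N : Type*} [LieRing N] [LieAlgebra K N]

theorem lift_apply_eq_zero (f : Fin g → N) (hN : ∀ a b c d : N, ⁅a, ⁅b, ⁅c, d⁆⁆⁆ = 0)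
    {x : FreeLieAlgebra K (Fin g)}
    (hx : x ∈ LieModule.lowerCentralSeries K (FreeLieAlgebra K (Fin g))
      (FreeLieAlgebra K (Fin g)) 3) : FreeLieAlgebra.lift K f x = 0 := by
  have step : ∀ (k : ℕ) (P : N → Prop), (∀ x ∈ LieModule.lowerCentralSeries K
      (FreeLieAlgebra K (Fin g)) (FreeLieAlgebra K (Fin g)) k, P (FreeLieAlgebra.lift K f x)) →
      ∀ Q : Submodule K N, (∀ a b : N, P b → ⁅a, b⁆ ∈ Q) →
      ∀ x ∈ LieModule.lowerCentralSeries K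
      (FreeLieAlgebra K (Fin g)) (FreeLieAlgebra K (Fin g)) (k + 1),
        FreeLieAlgebra.lift K f x ∈ Q := by
    intro k P hP Q hQ x hx
    rw [LieModule.lowerCentralSeries_succ, ← LieSubmodule.mem_toSubmodule,
      LieSubmodule.lieIdeal_oper_eq_linear_span'] at hx
    induction hx using Submodule.span_induction with
    | mem x hx =>
      obtain ⟨a, -, b, hb, rfl⟩ := hx
      rw [LieHom.map_lie]
      exact hQ _ _ (hP _ hb)
    | zero => simp
    | add x y _ _ hx hy => rw [map_add]; exact Q.add_mem hx hy
    | smul t x _ hx => rw [map_smul]; exact Q.smul_mem t hx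
  -- The images of successive lower central terms lie in the elements killed by two brackets, then
  -- by one, then in zero.
  have h1 := step 0 (fun _ => True) (fun _ _ => trivial)
    { carrier := {x | ∀ a b : N, ⁅a, ⁅b, x⁆⁆ = 0}
      zero_mem' := by intro a b; simp
      add_mem' := by intro x y hx hy a b; rw [lie_add, lie_add, hx, hy, add_zero]
      smul_mem' := by intro t x hx a b; rw [lie_smul, lie_smul, hx, smul_zero] }
    (fun c d _ a b => hN a b c d)
  have h2 := step 1 _ h1
    { carrier := {x | ∀ a : N, ⁅a, x⁆ = 0}
      zero_mem' := by intro a; simp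
      add_mem' := by intro x y hx hy a; rw [lie_add, hx, hy, add_zero]
      smul_mem' := by intro t x hx a; rw [lie_smul, hx, smul_zero] }
    (fun b x hx a => hx a b)
  exact step 2 _ h2 ⊥ (fun a x hx => hx a) x hx

/-- The universal property of the free-nilpotent Lie algebra of class three. -/
noncomputable def lift (f : Fin g → N) (hN : ∀ a b c d : N, ⁅a, ⁅b, ⁅c, d⁆⁆⁆ = 0) :
    FreeNilpotentLieAlgebra K g 3 →ₗ⁅K⁆ N where
  toLinearMap := Submodule.liftQ _ (FreeLieAlgebra.lift K f : FreeLieAlgebra K (Fin g) →ₗ[K] N)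
    fun _ hx => lift_apply_eq_zero f hN hx
  map_lie' := by
    intro x y
    obtain ⟨x, rfl⟩ := LieSubmodule.Quotient.surjective_mk' _ x
    obtain ⟨y, rfl⟩ := LieSubmodule.Quotient.surjective_mk' _ y
    exact (FreeLieAlgebra.lift K f).map_lie x y

@[simp]
theorem lift_gen (f : Fin g → N) (hN : ∀ a b c d : N, ⁅a, ⁅b, ⁅c, d⁆⁆⁆ = 0) (i : Fin g) :
    lift f hN (gen K i) = f i :=
  FreeLieAlgebra.lift_of_apply f i

end UniversalProperty
-- Coefficients of associative words, read off from matrices.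
section WordFunctionals

attribute [local instance] LieRing.ofAssociativeRing

variable {K : Type*} [Field K] {g : ℕ}

/-- The Lie algebra of strictly upper triangular matrices of size four. -/
def strictUpper (K : Type*) [Field K] : LieSubalgebra K (Matrix (Fin 4) (Fin 4) K) where
  carrier := {M | ∀ i j, j ≤ i → M i j = 0}
  zero_mem' := by intro i j _; rfl
  add_mem' := by
    intro M N hM hN i j hij
    rw [Matrix.add_apply, hM i j hij, hN i j hij, add_zero]
  smul_mem' := by
    intro t M hM i j hij
    rw [Matrix.smul_apply, hM i j hij, smul_zero]
  lie_mem' := by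
    intro M N hM hN i j hij
    have key : ∀ A B : Matrix (Fin 4) (Fin 4) K, (∀ i j, j ≤ i → A i j = 0) →
        (∀ i j, j ≤ i → B i j = 0) → (A * B) i j = 0 := by
      intro A B hA hB
      rw [Matrix.mul_apply]
      refine Finset.sum_eq_zero fun k _ => ?_
      rcases le_total k i with h | h
      · rw [hA i k h, zero_mul]
      · rw [hB k j (hij.trans h), mul_zero]
    rw [Ring.lie_def, Matrix.sub_apply, key M N hM hN, key N M hN hM, sub_zero]

theorem strictUpper_eq (M : strictUpper K) : (M : Matrix (Fin 4) (Fin 4) K) =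
    !![0, M.1 0 1, M.1 0 2, M.1 0 3; 0, 0, M.1 1 2, M.1 1 3; 0, 0, 0, M.1 2 3; 0, 0, 0, 0] := by
  ext i j
  fin_cases i <;> fin_cases j <;> first | rfl | exact M.2 _ _ (by decide)

theorem coe_strictUpper_lie (M N : strictUpper K) :
    (⁅M, N⁆ : strictUpper K).1 = !![0, 0, M.1 0 1 * N.1 1 2 - N.1 0 1 * M.1 1 2,
      M.1 0 1 * N.1 1 3 + M.1 0 2 * N.1 2 3 - (N.1 0 1 * M.1 1 3 + N.1 0 2 * M.1 2 3);
      0, 0, 0, M.1 1 2 * N.1 2 3 - N.1 1 2 * M.1 2 3; 0, 0, 0, 0; 0, 0, 0, 0] := by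
  rw [LieSubalgebra.coe_bracket, Ring.lie_def]
  conv_lhs => rw [strictUpper_eq M, strictUpper_eq N]
  ext i j
  fin_cases i <;> fin_cases j <;> simp

theorem strictUpper_lie_lie_lie_eq_zero (A B C D : strictUpper K) : ⁅A, ⁅B, ⁅C, D⁆⁆⁆ = 0 := by
  apply Subtype.ext
  rw [coe_strictUpper_lie, coe_strictUpper_lie, coe_strictUpper_lie]
  ext i j
  fin_cases i <;> fin_cases j <;> simp

/-- A matrix supported on the first superdiagonal. -/
def superdiagonal (a b c : K) : strictUpper K :=
  ⟨!![0, a, 0, 0; 0, 0, b, 0; 0, 0, 0, c; 0, 0, 0, 0], by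
    intro i j hij
    fin_cases i <;> fin_cases j <;> first | rfl | exact absurd hij (by decide)⟩

/-- The representation that sends the generators to matrices on the first superdiagonal. -/
noncomputable def superdiagonalRep (a b c : Fin g → K) :
    FreeNilpotentLieAlgebra K g 3 →ₗ⁅K⁆ strictUpper K :=
  lift (fun i => superdiagonal (a i) (b i) (c i)) strictUpper_lie_lie_lie_eq_zero

/-- A matrix entry of the representation `superdiagonalRep`. -/
noncomputable def entry (a b c : Fin g → K) (i j : Fin 4) :
    Module.Dual K (FreeNilpotentLieAlgebra K g 3) where
  toFun x := (superdiagonalRep a b c x).1 i j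
  map_add' x y := by rw [map_add]; rfl
  map_smul' t x := by rw [map_smul]; rfl

/-- The coefficient of a word of length one. -/
noncomputable def coeff₁ (p : Fin g) : Module.Dual K (FreeNilpotentLieAlgebra K g 3) :=
  entry (Pi.single p 1) 0 0 0 1

/-- The coefficient of a word of length two. -/
noncomputable def coeff₂ (p q : Fin g) : Module.Dual K (FreeNilpotentLieAlgebra K g 3) :=
  entry (Pi.single p 1) (Pi.single q 1) 0 0 2

/-- The coefficient of a word of length three. -/
noncomputable def coeff₃ (p q r : Fin g) : Module.Dual K (FreeNilpotentLieAlgebra K g 3) :=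
  entry (Pi.single p 1) (Pi.single q 1) (Pi.single r 1) 0 3

theorem superdiagonalRep_gen (a b c : Fin g → K) (i : Fin g) :
    superdiagonalRep a b c (gen K i) = superdiagonal (a i) (b i) (c i) := by
  rw [superdiagonalRep, lift_gen]

theorem coeff₁_gen (p i : Fin g) : coeff₁ p (gen K i) = if i = p then 1 else 0 := by
  change (superdiagonalRep _ _ _ (gen K i)).1 0 1 = _
  rw [superdiagonalRep_gen]
  simp [superdiagonal, Pi.single_apply]

theorem coeff₁_lie (p : Fin g) (x y : FreeNilpotentLieAlgebra K g 3) :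
    coeff₁ p ⁅x, y⁆ = 0 := by
  change (superdiagonalRep _ _ _ ⁅x, y⁆).1 0 1 = _
  rw [LieHom.map_lie, coe_strictUpper_lie]
  simp

theorem coeff₂_gen (p q i : Fin g) : coeff₂ p q (gen K i) = 0 := by
  change (superdiagonalRep _ _ _ (gen K i)).1 0 2 = _
  rw [superdiagonalRep_gen]
  simp [superdiagonal]

theorem coeff₂_lie_gen (p q i j : Fin g) : coeff₂ p q ⁅gen K i, gen K j⁆ =
    (if i = p ∧ j = q then 1 else 0) - if j = p ∧ i = q then 1 else 0 := by
  change (superdiagonalRep _ _ _ ⁅gen K i, gen K j⁆).1 0 2 = _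
  rw [LieHom.map_lie, coe_strictUpper_lie, superdiagonalRep_gen, superdiagonalRep_gen]
  simp only [superdiagonal, Pi.single_apply, ite_and, Matrix.of_apply, Matrix.cons_val]
  split_ifs <;> simp

theorem coeff₂_lie_lie (p q : Fin g) (x y z : FreeNilpotentLieAlgebra K g 3) :
    coeff₂ p q ⁅x, ⁅y, z⁆⁆ = 0 := by
  change (superdiagonalRep _ _ _ ⁅x, ⁅y, z⁆⁆).1 0 2 = _
  rw [LieHom.map_lie, LieHom.map_lie, coe_strictUpper_lie, coe_strictUpper_lie]
  simp

theorem coeff₃_gen (p q r i : Fin g) : coeff₃ p q r (gen K i) = 0 := by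
  change (superdiagonalRep _ _ _ (gen K i)).1 0 3 = _
  rw [superdiagonalRep_gen]
  simp [superdiagonal]

theorem coeff₃_lie_gen (p q r i j : Fin g) : coeff₃ p q r ⁅gen K i, gen K j⁆ = 0 := by
  change (superdiagonalRep _ _ _ ⁅gen K i, gen K j⁆).1 0 3 = _
  rw [LieHom.map_lie, coe_strictUpper_lie, superdiagonalRep_gen, superdiagonalRep_gen]
  simp [superdiagonal]

/-- The four terms are the words of `kij - kji - ijk + jik`. The corner entry multiplies the three
superdiagonal slots in order, so indicator vectors select the word `pqr`. -/
theorem coeff₃_lie_lie_gen (p q r k i j : Fin g) :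
    coeff₃ p q r ⁅gen K k, ⁅gen K i, gen K j⁆⁆ =
      (if k = p ∧ i = q ∧ j = r then 1 else 0) - (if k = p ∧ j = q ∧ i = r then 1 else 0)
        - (if i = p ∧ j = q ∧ k = r then 1 else 0) + if j = p ∧ i = q ∧ k = r then 1 else 0 := by
  change (superdiagonalRep _ _ _ ⁅gen K k, ⁅gen K i, gen K j⁆⁆).1 0 3 = _
  rw [LieHom.map_lie, LieHom.map_lie, coe_strictUpper_lie, coe_strictUpper_lie,
    superdiagonalRep_gen, superdiagonalRep_gen, superdiagonalRep_gen]
  simp only [superdiagonal, Pi.single_apply, ite_and, Matrix.of_apply, Matrix.cons_val]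
  split_ifs <;> simp

end WordFunctionals
-- The Hall basis and its cardinality.
section HallBasis

variable {K : Type*} [Field K] {g : ℕ}

/-- The Hall words of length two. -/
abbrev HallPair (g : ℕ) : Type := {p : Fin g × Fin g // p.1 < p.2}

/-- The Hall words of length three: `(i, j, k)` stands for `[x_k, [x_i, x_j]]`. -/
abbrev HallTriple (g : ℕ) : Type := {t : Fin g × Fin g × Fin g // t.1 < t.2.1 ∧ t.1 ≤ t.2.2}

/-- The Hall words of length at most three. -/
abbrev HallWord (g : ℕ) : Type := Fin g ⊕ HallPair g ⊕ HallTriple g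

/-- The element of the free-nilpotent Lie algebra given by a Hall word. -/
noncomputable def hallElement (K : Type*) [Field K] :
    HallWord g → FreeNilpotentLieAlgebra K g 3
  | .inl i => gen K i
  | .inr (.inl p) => ⁅gen K p.1.1, gen K p.1.2⁆
  | .inr (.inr t) => ⁅gen K t.1.2.2, ⁅gen K t.1.1, gen K t.1.2.1⁆⁆

/-- The coefficient of a Hall word. -/
noncomputable def hallCoeff (K : Type*) [Field K] :
    HallWord g → Module.Dual K (FreeNilpotentLieAlgebra K g 3)
  | .inl i => coeff₁ i
  | .inr (.inl p) => coeff₂ p.1.1 p.1.2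
  | .inr (.inr t) => coeff₃ t.1.1 t.1.2.1 t.1.2.2

theorem coeff₂_hallPair (p q : HallPair g) :
    coeff₂ q.1.1 q.1.2 ⁅gen K p.1.1, gen K p.1.2⁆ = if p = q then 1 else 0 := by
  obtain ⟨⟨a, b⟩, h⟩ := p
  obtain ⟨⟨c, d⟩, h'⟩ := q
  simp only at h h'
  rw [coeff₂_lie_gen, if_neg (fun H : b = c ∧ a = d => by omega), sub_zero]
  simp

/-- In `kij - kji - ijk + jik`, the word `ijk` has coefficient `-1`. If `i = k`, then `kji` is the
same word and the coefficient is `-2`, nonzero in characteristic zero. -/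
theorem coeff₃_hallTriple (s t : HallTriple g) :
    coeff₃ t.1.1 t.1.2.1 t.1.2.2 ⁅gen K s.1.2.2, ⁅gen K s.1.1, gen K s.1.2.1⁆⁆ =
      if s = t then (if t.1.1 = t.1.2.2 then -2 else -1) else 0 := by
  obtain ⟨⟨i, j, k⟩, h, h₁⟩ := s
  obtain ⟨⟨p, q, r⟩, h', h₁'⟩ := t
  simp only at h h' h₁ h₁'
  simp only [coeff₃_lie_lie_gen, Subtype.mk.injEq, Prod.mk.injEq]
  rw [if_neg (fun H : k = p ∧ i = q ∧ j = r => by omega),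
    if_neg (fun H : j = p ∧ i = q ∧ k = r => by omega)]
  by_cases hs : i = p ∧ j = q ∧ k = r
  · obtain ⟨rfl, rfl, rfl⟩ := hs
    by_cases hik : i = k
    · subst hik; simp; norm_num
    · simp [hik, Ne.symm hik]
  · rw [if_neg hs, if_neg hs, if_neg (fun H : k = p ∧ j = q ∧ i = r => by omega)]
    simp

theorem hallCoeff_hallElement_of_ne {s t : HallWord g} (h : s ≠ t) :
    hallCoeff K t (hallElement K s) = 0 := by
  rcases s with i | p | s <;> rcases t with j | q | t <;> simp only [hallCoeff, hallElement]
  · rw [coeff₁_gen, if_neg (by rintro rfl; exact h rfl)]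
  · rw [coeff₂_gen]
  · rw [coeff₃_gen]
  · rw [coeff₁_lie]
  · rw [coeff₂_hallPair, if_neg (by rintro rfl; exact h rfl)]
  · rw [coeff₃_lie_gen]
  · rw [coeff₁_lie]
  · rw [coeff₂_lie_lie]
  · rw [coeff₃_hallTriple, if_neg (by rintro rfl; exact h rfl)]

theorem hallCoeff_hallElement_self [CharZero K] (s : HallWord g) :
    hallCoeff K s (hallElement K s) ≠ 0 := by
  rcases s with i | p | s <;> simp only [hallCoeff, hallElement]
  · simp [coeff₁_gen]
  · simp [coeff₂_hallPair]
  · rw [coeff₃_hallTriple, if_pos rfl]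
    split_ifs <;> simp

theorem linearIndependent_hallElement [CharZero K] :
    LinearIndependent K (hallElement K : HallWord g → _) := by
  rw [linearIndependent_iff']
  intro S c hc s hs
  have h := congrArg (hallCoeff K s) hc
  rw [map_sum, map_zero, Finset.sum_eq_single s, map_smul, smul_eq_mul] at h
  · exact (mul_eq_zero.mp h).resolve_right (hallCoeff_hallElement_self s)
  · intro t _ hts
    rw [map_smul, hallCoeff_hallElement_of_ne hts, smul_zero]
  · exact fun h => absurd hs h

/-- The span of the Hall elements. -/
noncomputable def hallSpan (K : Type*) [Field K] (g : ℕ) :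
    Submodule K (FreeNilpotentLieAlgebra K g 3) :=
  Submodule.span K (Set.range (hallElement K))

theorem gen_mem_hallSpan (i : Fin g) : gen K i ∈ hallSpan K g :=
  Submodule.subset_span ⟨.inl i, rfl⟩

theorem lie_gen_mem_hallSpan (i j : Fin g) : ⁅gen K i, gen K j⁆ ∈ hallSpan K g := by
  rcases lt_trichotomy i j with h | rfl | h
  · exact Submodule.subset_span ⟨.inr (.inl ⟨(i, j), h⟩), rfl⟩
  · rw [lie_self]
    exact Submodule.zero_mem _
  · rw [← lie_skew]
    exact Submodule.neg_mem _ (Submodule.subset_span ⟨.inr (.inl ⟨(j, i), h⟩), rfl⟩)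

theorem lie_lie_gen_mem_hallSpan_of_lt (k : Fin g) {i j : Fin g} (hij : i < j) :
    ⁅gen K k, ⁅gen K i, gen K j⁆⁆ ∈ hallSpan K g := by
  rcases le_or_gt i k with h | h
  · exact Submodule.subset_span ⟨.inr (.inr ⟨(i, j, k), hij, h⟩), rfl⟩
  -- Here `k < i < j`: the Jacobi identity moves the least index inside the inner bracket.
  · rw [leibniz_lie, ← lie_skew]
    refine Submodule.add_mem _ (Submodule.neg_mem _ ?_) ?_
    · exact Submodule.subset_span ⟨.inr (.inr ⟨(k, i, j), h, (h.trans hij).le⟩), rfl⟩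
    · exact Submodule.subset_span ⟨.inr (.inr ⟨(k, j, i), h.trans hij, h.le⟩), rfl⟩

theorem lie_gen_hallSpan_mem (k : Fin g) {x : FreeNilpotentLieAlgebra K g 3}
    (hx : x ∈ hallSpan K g) : ⁅gen K k, x⁆ ∈ hallSpan K g := by
  have h : hallSpan K g ≤ (hallSpan K g).comap
      (LieModule.toEnd K (FreeNilpotentLieAlgebra K g 3) _ (gen K k)) := by
    refine Submodule.span_le.mpr ?_
    rintro _ ⟨i | p | t, rfl⟩
    · exact lie_gen_mem_hallSpan k i
    · exact lie_lie_gen_mem_hallSpan_of_lt k p.2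
    · simp only [hallElement, SetLike.mem_coe, Submodule.mem_comap, LieModule.toEnd_apply_apply]
      rw [lie_lie_lie_eq_zero]
      exact Submodule.zero_mem _
  exact h hx

theorem hallSpan_eq_top : hallSpan K g = ⊤ := by
  -- The elements stabilizing the span form a subalgebra by Jacobi. It contains the generators, so
  -- the span is an ideal, hence a subalgebra containing the generators.
  let S : LieSubalgebra K (FreeNilpotentLieAlgebra K g 3) :=
    { carrier := {x | ∀ y ∈ hallSpan K g, ⁅x, y⁆ ∈ hallSpan K g}
      zero_mem' := by
        intro y _
        rw [zero_lie]
        exact Submodule.zero_mem _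
      add_mem' := by
        intro x x' hx hx' y hy
        rw [add_lie]
        exact Submodule.add_mem _ (hx y hy) (hx' y hy)
      smul_mem' := by
        intro t x hx y hy
        rw [smul_lie]
        exact Submodule.smul_mem _ t (hx y hy)
      lie_mem' := by
        intro x x' hx hx' y hy
        rw [lie_lie]
        exact Submodule.sub_mem _ (hx _ (hx' y hy)) (hx' _ (hx y hy)) }
  have hS : S = ⊤ := lieSubalgebra_eq_top S fun i y hy => lie_gen_hallSpan_mem i hy
  let T : LieSubalgebra K (FreeNilpotentLieAlgebra K g 3) :=
    { hallSpan K g with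
      lie_mem' := by
        intro x y _ hy
        exact (show x ∈ S from hS ▸ LieSubalgebra.mem_top x) y hy }
  have hT : T = ⊤ := lieSubalgebra_eq_top T gen_mem_hallSpan
  exact eq_top_iff.mpr fun x _ => show x ∈ T from hT ▸ LieSubalgebra.mem_top x

/-- The Hall basis of the free-nilpotent Lie algebra of class three. -/
noncomputable def hallBasis (K : Type*) [Field K] [CharZero K] (g : ℕ) :
    Module.Basis (HallWord g) K (FreeNilpotentLieAlgebra K g 3) :=
  Module.Basis.mk linearIndependent_hallElement hallSpan_eq_top.ge

theorem coe_hallBasis [CharZero K] :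
    (hallBasis K g : HallWord g → FreeNilpotentLieAlgebra K g 3) = hallElement K :=
  Module.Basis.coe_mk _ _

theorem card_hallPair (g : ℕ) : Fintype.card (HallPair g) = g.choose 2 := by
  have h : Fintype.card (HallPair g) = ∑ i : Fin g, (Finset.Iio i).card := by
    rw [Fintype.card_subtype, Finset.card_filter, Fintype.sum_prod_type_right]
    simp_rw [← Finset.card_filter]
    refine Finset.sum_congr rfl fun i _ => congrArg _ ?_
    ext j
    simp
  rw [h]
  simp_rw [Fin.card_Iio]
  rw [Fin.sum_univ_eq_sum_range (fun i => i), Finset.sum_range_id, Nat.choose_two_right]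

theorem three_mul_card_hallTriple (g : ℕ) : 3 * Fintype.card (HallTriple g) + g = g ^ 3 := by
  have h : Fintype.card (HallTriple g) =
      ∑ i : Fin g, (Finset.Ioi i).card * (Finset.Ici i).card := by
    rw [Fintype.card_subtype, Finset.card_filter, Fintype.sum_prod_type]
    simp_rw [← Finset.card_filter]
    refine Finset.sum_congr rfl fun i _ => ?_
    rw [← Finset.card_product]
    refine congrArg _ ?_
    ext j
    simp
  rw [h]
  simp_rw [Fin.card_Ioi, Fin.card_Ici]
  rw [Fin.sum_univ_eq_sum_range (fun i => (g - 1 - i) * (g - i)), ← Finset.sum_range_reflect]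
  have h2 : ∀ n : ℕ, 3 * ∑ j ∈ Finset.range n, j * (j + 1) + n = n ^ 3 := by
    intro n
    induction n with
    | zero => rfl
    | succ n ih => rw [Finset.sum_range_succ]; linear_combination ih
  rw [← h2 g]
  congr 2
  refine Finset.sum_congr rfl fun j hj => ?_
  rw [Finset.mem_range] at hj
  congr 1 <;> omega

end HallBasis
end FreeNilpotentLieAlgebra

/-! ### Isotropy bound for abelian subalgebras. -/

section AbelianSubalgebras

variable {K L : Type*} [Field K] [LieRing L] [LieAlgebra K L]

/-- The bilinear form `(x, y) ↦ l ⁅x, y⁆`. -/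
noncomputable def lieForm (l : Module.Dual K L) : LinearMap.BilinForm K L :=
  (LieModule.toEnd K L L : L →ₗ[K] Module.End K L).compr₂ l

theorem lieForm_apply (l : Module.Dual K L) (x y : L) : lieForm l x y = l ⁅x, y⁆ := rfl

theorem lieForm_isRefl (l : Module.Dual K L) : (lieForm l).IsRefl := by
  intro x y h
  rw [lieForm_apply] at h ⊢
  rw [← lie_skew, map_neg, h, neg_zero]

/-- An abelian subalgebra is isotropic for the form `(x, y) ↦ l ⁅x, y⁆`. -/
theorem two_mul_finrank_le_of_isLieAbelian [FiniteDimensional K L] (A : LieSubalgebra K L)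
    (hA : IsLieAbelian A) (l : Module.Dual K L) :
    2 * Module.finrank K A ≤ Module.finrank K L + Module.finrank K (lieFormRadical l) := by
  have h1 : A.toSubmodule ≤ (lieForm l).orthogonal A.toSubmodule := by
    intro x hx y hy
    have h : ⁅y, x⁆ = 0 :=
      congrArg Subtype.val (trivial_lie_zero A A (⟨y, hy⟩ : A) (⟨x, hx⟩ : A))
    change l ⁅y, x⁆ = 0
    rw [h, map_zero]
  have h2 : A.toSubmodule ⊓ (lieForm l).orthogonal ⊤ ≤ (lieFormRadical l).toSubmodule :=
    fun x hx y => hx.2 y trivial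
  -- `dim A + dim A^⊥ = dim L + dim (A ∩ L^⊥)`, with `A ⊆ A^⊥` and `L^⊥` contained in the radical.
  have h3 := LinearMap.BilinForm.finrank_add_finrank_orthogonal (lieForm_isRefl l) A.toSubmodule
  have h4 := Submodule.finrank_mono h1
  have h5 := Submodule.finrank_mono h2
  change 2 * Module.finrank K A.toSubmodule ≤
    Module.finrank K L + Module.finrank K (lieFormRadical l).toSubmodule
  omega

/-- If an abelian subalgebra and a linear form attain equality in
`two_mul_finrank_le_of_isLieAbelian`, then they compute the invariants `α` and `χ`. -/
theorem lieAlpha_lieIndex_eq [FiniteDimensional K L] (A : LieSubalgebra K L)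
    (hA : IsLieAbelian A) (l : Module.Dual K L)
    (h : Module.finrank K L + Module.finrank K (lieFormRadical l) ≤ 2 * Module.finrank K A) :
    lieAlpha K L = Module.finrank K A ∧
      lieIndex K L = Module.finrank K (lieFormRadical l) := by
  constructor
  · refine IsGreatest.csSup_eq ⟨⟨A, hA, rfl⟩, ?_⟩
    rintro _ ⟨B, hB, rfl⟩
    have := two_mul_finrank_le_of_isLieAbelian B hB l
    omega
  · refine IsLeast.csInf_eq ⟨⟨l, rfl⟩, ?_⟩
    rintro _ ⟨m, rfl⟩
    have := two_mul_finrank_le_of_isLieAbelian A hA m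
    omega

end AbelianSubalgebras

namespace FreeNilpotentLieAlgebra

/-! ### The extremal linear form, the center and the dimensions. -/

section Invariants

variable {K : Type*} [Field K] {g : ℕ}

/-- The span of the Hall elements of degree two and three. -/
noncomputable def derivedSpan (K : Type*) [Field K] (g : ℕ) :
    Submodule K (FreeNilpotentLieAlgebra K g 3) :=
  Submodule.span K (Set.range (hallElement K ∘ Sum.inr : HallPair g ⊕ HallTriple g → _))

theorem derivedSpan_le (Q : Submodule K (FreeNilpotentLieAlgebra K g 3))
    (h : ∀ a b : FreeNilpotentLieAlgebra K g 3, ⁅a, b⁆ ∈ Q) : derivedSpan K g ≤ Q := by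
  refine Submodule.span_le.mpr ?_
  rintro _ ⟨p | t, rfl⟩
  · exact h _ _
  · exact h _ _

theorem lie_eq_zero_of_mem_derivedSpan {x y : FreeNilpotentLieAlgebra K g 3}
    (hx : x ∈ derivedSpan K g) (hy : y ∈ derivedSpan K g) : ⁅x, y⁆ = 0 := by
  have key : ∀ z : FreeNilpotentLieAlgebra K g 3,
      (∀ a b : FreeNilpotentLieAlgebra K g 3, ⁅z, ⁅a, b⁆⁆ = 0) →
      ∀ w ∈ derivedSpan K g, ⁅z, w⁆ = 0 := fun z hz w hw =>
    derivedSpan_le (LinearMap.ker (LieModule.toEnd K (FreeNilpotentLieAlgebra K g 3) _ z))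
      (fun a b => hz a b) hw
  refine key x (fun a b => ?_) y hy
  rw [← lie_skew, neg_eq_zero]
  exact key _ (fun c d => lie_lie_of_lie_eq_zero a b c d) x hx

/-- The subalgebra spanned by the Hall elements of degree two and three. -/
noncomputable def derivedSubalgebra (K : Type*) [Field K] (g : ℕ) :
    LieSubalgebra K (FreeNilpotentLieAlgebra K g 3) where
  toSubmodule := derivedSpan K g
  lie_mem' := by
    intro x y hx hy
    rw [lie_eq_zero_of_mem_derivedSpan hx hy]
    exact Submodule.zero_mem _

theorem isLieAbelian_derivedSubalgebra : IsLieAbelian (derivedSubalgebra K g) :=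
  ⟨fun x y => Subtype.ext (lie_eq_zero_of_mem_derivedSpan x.2 y.2)⟩

/-- The linear form `x ↦ F ⁅y, x⁆`. -/
noncomputable def dualLie (F : Module.Dual K (FreeNilpotentLieAlgebra K g 3))
    (y : FreeNilpotentLieAlgebra K g 3) : Module.Dual K (FreeNilpotentLieAlgebra K g 3) :=
  F.comp (LieModule.toEnd K (FreeNilpotentLieAlgebra K g 3) (FreeNilpotentLieAlgebra K g 3) y)

theorem dualLie_apply (F : Module.Dual K (FreeNilpotentLieAlgebra K g 3))
    (y x : FreeNilpotentLieAlgebra K g 3) : dualLie F y x = F ⁅y, x⁆ := rfl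

/-- A linear form of degree three, for a self-map `σ` of the set of generators. -/
noncomputable def cyclicForm (K : Type*) [Field K] (σ : Fin g → Fin g) :
    Module.Dual K (FreeNilpotentLieAlgebra K g 3) :=
  ∑ i, coeff₃ i i (σ i)

theorem cyclicForm_lie_gen (σ : Fin g → Fin g) (i j : Fin g) :
    cyclicForm K σ ⁅gen K i, gen K j⁆ = 0 := by
  simp [cyclicForm, LinearMap.sum_apply, coeff₃_lie_gen]

/-- The form sums the coefficients of the words `j j (σ j)`. Of the four words in the bracket, `k i
(σ i)` contributes exactly when `k = i`; `k (σ i) i` would need a 2-cycle of `σ`, and the other two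
a fixed point. -/
theorem cyclicForm_lie_lie_gen {σ : Fin g → Fin g} (h1 : ∀ i, σ i ≠ i) (h2 : ∀ i, σ (σ i) ≠ i)
    (k i : Fin g) : cyclicForm K σ ⁅gen K k, ⁅gen K i, gen K (σ i)⁆⁆ = if k = i then 1 else 0 := by
  rw [cyclicForm, LinearMap.sum_apply, Finset.sum_eq_single k]
  · rw [coeff₃_lie_lie_gen, if_neg (c := k = k ∧ σ i = k ∧ i = σ k),
      if_neg (c := i = k ∧ σ i = k ∧ k = σ k), if_neg (c := σ i = k ∧ i = k ∧ k = σ k)]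
    · by_cases hki : k = i
      · subst hki; simp
      · simp [hki, Ne.symm hki]
    · exact fun H => h1 _ H.2.2.symm
    · exact fun H => h1 _ H.2.2.symm
    · rintro ⟨-, rfl, H⟩
      exact h2 i H.symm
  · intro j _ hj
    rw [coeff₃_lie_lie_gen, if_neg (fun H => hj H.1.symm), if_neg (fun H => hj H.1.symm),
      if_neg, if_neg]
    · simp
    · rintro ⟨rfl, H, -⟩
      exact h1 _ H.symm
    · rintro ⟨rfl, H, -⟩
      exact h1 _ H
  · exact fun h => absurd (Finset.mem_univ k) h

/-- The pairing of an element with the generators and with the brackets `⁅x_k, x_{σ k}⁆`. -/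
noncomputable def cyclicPairing (K : Type*) [Field K] (σ : Fin g → Fin g) :
    FreeNilpotentLieAlgebra K g 3 →ₗ[K] (Fin g → K) × (Fin g → K) :=
  (LinearMap.pi fun k => dualLie (cyclicForm K σ) (gen K k)).prod
    (LinearMap.pi fun k => dualLie (cyclicForm K σ) ⁅gen K k, gen K (σ k)⁆)

/-- The pairing is block antidiagonal: brackets `[x_i, x_{σ i}]` hit only the first factor,
generators only the second, giving standard basis vectors up to sign. -/
theorem range_cyclicPairing {σ : Fin g → Fin g} (h1 : ∀ i, σ i ≠ i) (h2 : ∀ i, σ (σ i) ≠ i) :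
    LinearMap.range (cyclicPairing K σ) = ⊤ := by
  have ha : ∀ i, cyclicPairing K σ ⁅gen K i, gen K (σ i)⁆ = (Pi.single i 1, 0) := by
    intro i
    refine Prod.ext (funext fun k => ?_) (funext fun k => ?_)
    · change cyclicForm K σ ⁅gen K k, ⁅gen K i, gen K (σ i)⁆⁆ = _
      rw [cyclicForm_lie_lie_gen h1 h2]
      exact (Pi.single_apply i 1 k).symm
    · change cyclicForm K σ ⁅⁅gen K k, gen K (σ k)⁆, ⁅gen K i, gen K (σ i)⁆⁆ = _
      rw [lie_lie_of_lie_eq_zero, map_zero]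
      rfl
  have hb : ∀ i, cyclicPairing K σ (gen K i) = (0, -Pi.single i 1) := by
    intro i
    refine Prod.ext (funext fun k => ?_) (funext fun k => ?_)
    · exact cyclicForm_lie_gen σ k i
    · change cyclicForm K σ ⁅⁅gen K k, gen K (σ k)⁆, gen K i⁆ = _
      rw [← lie_skew, map_neg, cyclicForm_lie_lie_gen h1 h2]
      simp [Pi.single_apply, eq_comm]
  rw [LinearMap.range_eq_top]
  rintro ⟨v, w⟩
  refine ⟨∑ i, v i • ⁅gen K i, gen K (σ i)⁆ - ∑ i, w i • gen K i, ?_⟩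
  rw [map_sub, map_sum, map_sum]
  simp_rw [map_smul, ha, hb]
  refine Prod.ext (funext fun k => ?_) (funext fun k => ?_)
  · simp [Prod.fst_sum, Finset.sum_apply, Pi.single_apply]
  · simp [Prod.snd_sum, Finset.sum_apply, Pi.single_apply]

variable [CharZero K]

theorem finrank_derivedSubalgebra : Module.finrank K (derivedSubalgebra K g) =
    g.choose 2 + Fintype.card (HallTriple g) := by
  rw [← card_hallPair, ← Fintype.card_sum]
  exact finrank_span_eq_card (linearIndependent_hallElement.comp _ Sum.inr_injective)

theorem finite (K : Type*) [Field K] [CharZero K] (g : ℕ) :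
    Module.Finite K (FreeNilpotentLieAlgebra K g 3) :=
  Module.Finite.of_basis (hallBasis K g)

theorem finrank_eq : Module.finrank K (FreeNilpotentLieAlgebra K g 3) =
    g + (g.choose 2 + Fintype.card (HallTriple g)) := by
  rw [Module.finrank_eq_card_basis (hallBasis K g), Fintype.card_sum, Fintype.card_sum,
    card_hallPair, Fintype.card_fin]

theorem hallBasis_repr_eq_zero (F : Module.Dual K (FreeNilpotentLieAlgebra K g 3))
    (s : HallWord g) (hs : F (hallElement K s) ≠ 0)
    (h : ∀ t, t ≠ s → F (hallElement K t) = 0) {x : FreeNilpotentLieAlgebra K g 3}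
    (hx : F x = 0) : (hallBasis K g).repr x s = 0 := by
  rw [← (hallBasis K g).sum_repr x, map_sum, Finset.sum_eq_single s, map_smul, smul_eq_mul,
    coe_hallBasis] at hx
  · exact (mul_eq_zero.mp hx).resolve_right hs
  · intro t _ hts
    rw [map_smul, coe_hallBasis, h t hts, smul_zero]
  · exact fun h => absurd (Finset.mem_univ s) h

theorem hallBasis_repr_inl_of_mem_center (hg : 2 ≤ g) {x : FreeNilpotentLieAlgebra K g 3}
    (hx : ∀ y : FreeNilpotentLieAlgebra K g 3, ⁅y, x⁆ = 0) (j : Fin g) :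
    (hallBasis K g).repr x (.inl j) = 0 := by
  have : Nontrivial (Fin g) := Fin.nontrivial_iff_two_le.mpr hg
  obtain ⟨i, hij⟩ := exists_ne j
  -- Bracketing with `x_i`, `i ≠ j`, and reading the word `ij` isolates the coordinate of `x_j`.
  refine hallBasis_repr_eq_zero (dualLie (coeff₂ i j) (gen K i)) _ ?_ ?_ ?_
  · rw [dualLie_apply, hallElement, coeff₂_lie_gen]
    simp [hij]
  · rintro (k | p | t) hk
    · rw [dualLie_apply, hallElement, coeff₂_lie_gen, if_neg, if_neg, sub_zero]
      · exact fun H => hij H.2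
      · rintro ⟨-, rfl⟩
        exact hk rfl
    · exact coeff₂_lie_lie i j (gen K i) (gen K p.1.1) (gen K p.1.2)
    · exact coeff₂_lie_lie i j (gen K i) (gen K t.1.2.2) ⁅gen K t.1.1, gen K t.1.2.1⁆
  · rw [dualLie_apply, hx, map_zero]

theorem hallBasis_repr_hallPair_of_mem_center (hg : 2 ≤ g) {x : FreeNilpotentLieAlgebra K g 3}
    (hx : ∀ y : FreeNilpotentLieAlgebra K g 3, ⁅y, x⁆ = 0) (p : HallPair g) :
    (hallBasis K g).repr x (.inr (.inl p)) = 0 := by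
  -- The largest index is always admissible as outer letter, so `ad x_m` maps Hall pairs injectively
  -- to Hall triples.
  let m : Fin g := ⟨g - 1, by omega⟩
  have hm : ∀ i : Fin g, i ≤ m := fun i => by
    rw [Fin.le_def]
    have := i.2
    change i.1 ≤ g - 1
    omega
  let e : HallPair g → HallTriple g := fun q => ⟨(q.1.1, q.1.2, m), q.2, hm _⟩
  have he : Function.Injective e := by
    intro q q' h
    simp only [e, Subtype.mk.injEq, Prod.mk.injEq] at h
    exact Subtype.ext (Prod.ext h.1 h.2.1)
  have hp : ∀ q : HallPair g, ⁅gen K m, hallElement K (.inr (.inl q))⁆ =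
      hallElement K (.inr (.inr (e q))) := fun q => rfl
  refine hallBasis_repr_eq_zero (dualLie (hallCoeff K (.inr (.inr (e p)))) (gen K m)) _ ?_ ?_ ?_
  · rw [dualLie_apply, hp]
    exact hallCoeff_hallElement_self _
  · rintro (k | q | t) hk
    · exact coeff₃_lie_gen _ _ _ _ _
    · rw [dualLie_apply, hp]
      refine hallCoeff_hallElement_of_ne fun h => hk ?_
      rw [he (Sum.inr_injective (Sum.inr_injective h))]
    · rw [dualLie_apply, hallElement, lie_lie_lie_eq_zero, map_zero]
  · rw [dualLie_apply, hx, map_zero]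

theorem finrank_center (hg : 2 ≤ g) :
    Module.finrank K (LieAlgebra.center K (FreeNilpotentLieAlgebra K g 3)) =
      Fintype.card (HallTriple g) := by
  have h : (LieAlgebra.center K (FreeNilpotentLieAlgebra K g 3)).toSubmodule =
      Submodule.span K (Set.range (hallElement K ∘ Sum.inr ∘ Sum.inr : HallTriple g → _)) := by
    refine le_antisymm (fun x hx => ?_) (Submodule.span_le.mpr ?_)
    · have hx' : ∀ y : FreeNilpotentLieAlgebra K g 3, ⁅y, x⁆ = 0 :=
        (LieModule.mem_maxTrivSubmodule _ _ _ x).mp hx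
      rw [← (hallBasis K g).sum_repr x]
      refine Submodule.sum_mem _ ?_
      rintro (i | p | t) -
      · rw [hallBasis_repr_inl_of_mem_center hg hx', zero_smul]
        exact Submodule.zero_mem _
      · rw [hallBasis_repr_hallPair_of_mem_center hg hx', zero_smul]
        exact Submodule.zero_mem _
      · refine Submodule.smul_mem _ _ (Submodule.subset_span ⟨t, ?_⟩)
        rw [coe_hallBasis]
        rfl
    · rintro _ ⟨t, rfl⟩
      exact (LieModule.mem_maxTrivSubmodule _ _ _ _).mpr fun y => lie_lie_lie_eq_zero _ _ _ _
  change Module.finrank K (LieAlgebra.center K (FreeNilpotentLieAlgebra K g 3)).toSubmodule = _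
  rw [h]
  exact finrank_span_eq_card
    (linearIndependent_hallElement.comp _ (Sum.inr_injective.comp Sum.inr_injective))

theorem finrank_lieFormRadical_cyclicForm_le {σ : Fin g → Fin g} (h1 : ∀ i, σ i ≠ i)
    (h2 : ∀ i, σ (σ i) ≠ i) :
    2 * g + Module.finrank K (lieFormRadical (cyclicForm K σ)) ≤
      Module.finrank K (FreeNilpotentLieAlgebra K g 3) := by
  have := finite K g
  have hle : (lieFormRadical (cyclicForm K σ)).toSubmodule ≤
      LinearMap.ker (cyclicPairing K σ) := fun y hy =>
    Prod.ext (funext fun k => hy (gen K k))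
      (funext fun k => hy ⁅gen K k, gen K (σ k)⁆)
  have h3 := Submodule.finrank_mono hle
  have h4 := LinearMap.finrank_range_add_finrank_ker (cyclicPairing K σ)
  rw [range_cyclicPairing h1 h2, finrank_top, Module.finrank_prod, Module.finrank_fin_fun] at h4
  change 2 * g + Module.finrank K (lieFormRadical (cyclicForm K σ)).toSubmodule ≤ _
  omega

theorem exists_self_map_without_short_cycles (hg : 3 ≤ g) :
    ∃ σ : Fin g → Fin g, (∀ i, σ i ≠ i) ∧ ∀ i, σ (σ i) ≠ i := by
  refine ⟨fun i => ⟨if i.1 + 1 < g then i.1 + 1 else 0, by split_ifs <;> omega⟩, ?_, ?_⟩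
  all_goals
    intro i h
    have hi := i.2
    rw [Fin.ext_iff] at h
    dsimp only at h
    split_ifs at h <;> omega

end Invariants
end FreeNilpotentLieAlgebra

theorem mainTheorem5 (K : Type*) [Field K] [IsAlgClosed K] [CharZero K] (g : ℕ) (hg : 3 ≤ g) :
    Module.Finite K (FreeNilpotentLieAlgebra K g 3) ∧
    lieAlpha K (FreeNilpotentLieAlgebra K g 3) =
      Module.finrank K (LieAlgebra.center K (FreeNilpotentLieAlgebra K g 3)) + g.choose 2 ∧
    lieAlpha K (FreeNilpotentLieAlgebra K g 3) =
      lieIndex K (FreeNilpotentLieAlgebra K g 3) + g ∧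
    (lieAlpha K (FreeNilpotentLieAlgebra K g 3) : ℚ) =
      (2 * (g : ℚ) ^ 3 + 3 * (g : ℚ) ^ 2 - 5 * (g : ℚ)) / 6 := by
  open FreeNilpotentLieAlgebra in
  have := finite K g
  obtain ⟨σ, h1, h2⟩ := exists_self_map_without_short_cycles hg
  have hr := finrank_lieFormRadical_cyclicForm_le (K := K) h1 h2
  have hd := finrank_eq (K := K) (g := g)
  have hD := finrank_derivedSubalgebra (K := K) (g := g)
  -- Together with `hr`, this forces the radical to have dimension exactly `dim D - g`.
  have hlow := two_mul_finrank_le_of_isLieAbelian (derivedSubalgebra K g)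
    isLieAbelian_derivedSubalgebra (cyclicForm K σ)
  obtain ⟨hα, hχ⟩ := lieAlpha_lieIndex_eq (derivedSubalgebra K g)
    isLieAbelian_derivedSubalgebra (cyclicForm K σ) (by omega)
  refine ⟨inferInstance, ?_, ?_, ?_⟩
  · rw [hα, hD, finrank_center (by omega), add_comm]
  · rw [hα, hχ]
    omega
  · have h3 : (3 * Fintype.card (HallTriple g) + g : ℚ) = (g : ℚ) ^ 3 := by
      exact_mod_cast three_mul_card_hallTriple g
    rw [hα, hD, Nat.cast_add, Nat.cast_choose_two]
    linear_combination h3 / 3
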